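/- Let $\widetilde M$ be a complete simply connected $n$-dimensional Riemannian manifold whose sectional curvatures satisfy $-b^2\le k\le -1$ for some $b\ge 1$, let $d$ be its distance and $\partial_\infty\widetilde M$ its boundary at infinity (the classes of asymptotic geodesic rays, with the cone topology on $\widetilde M\cup\partial_\infty\widetilde M$). Fix $o\in\widetilde M$. For $\xi\in\partial_\infty\widetilde M$ let $\xi_t$ be the point at distance $t$ from $o$ on the geodesic ray $[o,\xi)$, and for $z\in\widetilde M\setminus\{o\}$ let $z^+\in\partial_\infty\widetilde M$ be the extremity of the geodesic ray starting at $o$ which contains $z$. Put $\langle w_1,w_2\rangle_o=\frac12\big(d(w_1,o)+d(o,w_2)-d(w_1,w_2)\big)$, $\langle\xi_1,\xi_2\rangle_o=\lim_{w_1\to\xi_1,\,w_2\to\xi_2}\langle w_1,w_2\rangle_o$, and let $\rho(\xi_1,\xi_2)=e^{-\langle\xi_1,\xi_2\rangle_o}$ if $\xi_1\ne\xi_2$, $\rho(\xi,\xi)=0$, be the visual distance on $\partial_\infty\widetilde M$; $\mathfrak B(\eta,r)=\{\xi:\rho(\eta,\xi)<r\}$ denotes its balls. Let $\Gamma$ be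 a discrete group of isometries of $\widetilde M$, let $\Lambda\subset\partial_\infty\widetilde M$ be its limit set (the boundary points in the closure of $\Gamma\cdot o$), and for $\alpha,\kappa>0$ put $$\Lambda^l(\alpha)=\Big\{\xi\in\Lambda:\liminf_{t\to\infty}\tfrac1t\,d(\xi_t,\Gamma\cdot o)>\alpha\Big\},$$ $$\Lambda^r(\kappa)=\bigcup_{c>0}\Big\{\xi\in\Lambda:\ \xi\in\mathfrak B\big((\gamma\cdot o)^+,\,c\,e^{-\frac1{1+\kappa}d(o,\gamma\cdot o)}\big)\text{ for infinitely many }\gamma\in\Gamma\text{ with }\gamma\cdot o\ne o\Big\}.$$ Let $0<\alpha<\beta<1/5$. Then for every $\xi\in\Lambda\setminus\Lambda^l(\alpha)$ there exist $c\ge1$ and a sequence $(\gamma_n)_n$ in $\Gamma$, with the points $\gamma_n\cdot o$ pairwise distinct and different from $o$, such that $$\xi\in\mathfrak B\Big((\gamma_n\cdot o)^+,\ c\,e^{-\frac{1-2\beta-\beta^2}{1-\beta^2}\,d(o,\gamma_n\cdot o)}\Big)\qquad\text{for every }n.$$ In particular, $\Lambda\setminus\Lambda^l(\alpha)\subset\Lambda^r\Big(\dfrac{2\beta}{1-2\beta-\beta^2}\Big)$.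 -/

import Mathlib

open Set Filter Topology Manifold Bundle
open scoped NNReal ENNReal ContDiff

noncomputable section

namespace KleinianLimit

/-! ### Sectional curvature of a Riemannian metric -/

section Curvature

variable {n : ℕ}

/-- Partial derivative `∂ᵢ f` of a function on `ℝⁿ`. -/
def partialD (i : Fin n) (f : EuclideanSpace ℝ (Fin n) → ℝ) (y : EuclideanSpace ℝ (Fin n)) : ℝ :=
  fderiv ℝ f y (EuclideanSpace.single i 1)

/-- Christoffel symbols
`Γᵏᵢⱼ = ½ ∑ₗ gᵏˡ (∂ᵢ gⱼₗ + ∂ⱼ gᵢₗ - ∂ₗ gᵢⱼ)` of a metric given by its matrix of coefficients. -/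
def christoffel (g : EuclideanSpace ℝ (Fin n) → Matrix (Fin n) (Fin n) ℝ) (k i j : Fin n)
    (y : EuclideanSpace ℝ (Fin n)) : ℝ :=
  (1 / 2) * ∑ l, (g y)⁻¹ k l *
    (partialD i (fun z => g z j l) y + partialD j (fun z => g z i l) y
      - partialD l (fun z => g z i j) y)

/-- Components of the Riemann tensor, `R(∂ᵢ, ∂ⱼ) ∂ₖ = ∑ₗ Rˡᵢⱼₖ ∂ₗ`, where
`R(X, Y) Z = ∇_X ∇_Y Z - ∇_Y ∇_X Z - ∇_[X,Y] Z`. -/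
def riemannTensor (g : EuclideanSpace ℝ (Fin n) → Matrix (Fin n) (Fin n) ℝ) (l i j k : Fin n)
    (y : EuclideanSpace ℝ (Fin n)) : ℝ :=
  partialD i (christoffel g l j k) y - partialD j (christoffel g l i k) y
    + ∑ m, (christoffel g m j k y * christoffel g l i m y
      - christoffel g m i k y * christoffel g l j m y)

/-- The value `g(u, v)` at `y` of the metric on two coordinate vectors. -/
def metricForm (g : EuclideanSpace ℝ (Fin n) → Matrix (Fin n) (Fin n) ℝ)
    (y u v : EuclideanSpace ℝ (Fin n)) : ℝ :=
  ∑ i, ∑ j, g y i j * u i * v j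

/-- Sectional curvature `g(R(u, v) v, u) / (g(u, u) g(v, v) - g(u, v)²)` at `y` of the plane
spanned by two linearly independent coordinate vectors `u`, `v`. -/
def sectionalCurvature (g : EuclideanSpace ℝ (Fin n) → Matrix (Fin n) (Fin n) ℝ)
    (y u v : EuclideanSpace ℝ (Fin n)) : ℝ :=
  (∑ i, ∑ j, ∑ k, ∑ l, ∑ m, g y l m * riemannTensor g l i j k y * u i * v j * v k * u m) /
    (metricForm g y u u * metricForm g y v v - metricForm g y u v ^ 2)

variable (M : Type*) [MetricSpace M] [ChartedSpace (EuclideanSpace ℝ (Fin n)) M]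
  [RiemannianBundle (fun x : M => TangentSpace 𝓘(ℝ, EuclideanSpace ℝ (Fin n)) x)]

/-- The coefficients `gᵢⱼ` of the Riemannian metric of `M` in the preferred chart `φ` at `p`: at a
point `y` of the target of `φ`, `gᵢⱼ(y)` is the inner product in `T_{φ⁻¹(y)} M` of the images of
the `i`-th and `j`-th basis vectors under the differential of `φ⁻¹`. -/
def metricCoeff (p : M) (y : EuclideanSpace ℝ (Fin n)) : Matrix (Fin n) (Fin n) ℝ :=
  Matrix.of fun i j =>
    inner ℝ
      (mfderiv 𝓘(ℝ, EuclideanSpace ℝ (Fin n)) 𝓘(ℝ, EuclideanSpace ℝ (Fin n))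
        (chartAt (EuclideanSpace ℝ (Fin n)) p).symm y (EuclideanSpace.single i 1 : EuclideanSpace ℝ (Fin n)) :
        TangentSpace 𝓘(ℝ, EuclideanSpace ℝ (Fin n)) ((chartAt (EuclideanSpace ℝ (Fin n)) p).symm y))
      (mfderiv 𝓘(ℝ, EuclideanSpace ℝ (Fin n)) 𝓘(ℝ, EuclideanSpace ℝ (Fin n))
        (chartAt (EuclideanSpace ℝ (Fin n)) p).symm y (EuclideanSpace.single j 1 : EuclideanSpace ℝ (Fin n)))

variable (n) in
/-- All sectional curvatures `k` of the Riemannian manifold `M` satisfy `-b² ≤ k ≤ -1`. At each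
point `p` they are computed in the preferred chart at `p`. -/
def PinchedCurvature (b : ℝ) : Prop :=
  ∀ (p : M) (u v : EuclideanSpace ℝ (Fin n)), LinearIndependent ℝ ![u, v] →
    sectionalCurvature (metricCoeff M p) (chartAt (EuclideanSpace ℝ (Fin n)) p p) u v
      ∈ Icc (-b ^ 2) (-1)

end Curvature

/-! ### The boundary at infinity -/

section Boundary

variable (M : Type*) [MetricSpace M]

/-- Unit speed geodesic rays `[0, ∞) → M`, that is, isometric embeddings of `[0, ∞)`. -/
def GeodesicRay : Type _ := {r : ℝ≥0 → M // Isometry r}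

/-- Two geodesic rays are asymptotic if they stay at bounded distance. -/
def asymptotic : Setoid (GeodesicRay M) where
  r r s := ∃ C : ℝ, ∀ t, dist (r.1 t) (s.1 t) ≤ C
  iseqv :=
    { refl := fun r => ⟨0, fun t => by simp⟩
      symm := fun ⟨C, h⟩ => ⟨C, fun t => by rw [dist_comm]; exact h t⟩
      trans := fun ⟨C, h⟩ ⟨D, k⟩ => ⟨C + D, fun t =>
        (dist_triangle _ _ _).trans (add_le_add (h t) (k t))⟩ }

/-- The boundary at infinity: classes of asymptotic geodesic rays. -/
def Boundary : Type _ := Quotient (asymptotic M)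

variable {M}

open Classical in
/-- The point `ξ_t` at distance `t` from `o` on the geodesic ray `[o, ξ)`, the ray of the class `ξ`
that starts at `o`. (There is exactly one such ray in a complete simply connected manifold of
nonpositive curvature; the value `o` is never used there.) -/
def Boundary.point (o : M) (ξ : Boundary M) (t : ℝ≥0) : M :=
  if h : ∃ r : GeodesicRay M, r.1 0 = o ∧ Quotient.mk (asymptotic M) r = ξ then h.choose.1 t else o

/-- The geodesic ray `[o, ξ)` as a set. -/
def rayTo (o : M) (ξ : Boundary M) : Set M := range (ξ.point o)

/-- The geodesic segment `[x, y]`. -/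
def geodSegment (x y : M) : Set M := {z | dist x z + dist z y = dist x y}

/-- The neighborhoods of `ξ` in the cone topology, traced on `M`: the filter generated by the sets
of those `w` at distance more than `T` from `o` such that the point of `[o, w]` at distance `T`
from `o` is `ε`-close to `ξ_T`. -/
def coneNhds (o : M) (ξ : Boundary M) : Filter M :=
  ⨅ (T : ℝ≥0) (ε : ℝ) (_ : 0 < ε),
    𝓟 {w | (T : ℝ) < dist o w ∧ ∃ x ∈ geodSegment o w, dist o x = T ∧ dist x (ξ.point o T) < ε}

/-- The Gromov product at `z` of two points of `M`. -/
def gromovProduct (z w₁ w₂ : M) : ℝ := (dist w₁ z + dist z w₂ - dist w₁ w₂) / 2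

/-- The Gromov product at `o` of two boundary points, the limit of `⟨w₁, w₂⟩_o` as `w₁ → ξ₁` and
`w₂ → ξ₂`. It is written as a lower limit, which is the limit whenever the limit exists
(as it does for curvature at most `-1`). -/
def boundaryGromovProduct (o : M) (ξ₁ ξ₂ : Boundary M) : EReal :=
  liminf (fun w : M × M => ((gromovProduct o w.1 w.2 : ℝ) : EReal))
    (coneNhds o ξ₁ ×ˢ coneNhds o ξ₂)

open Classical in
/-- The Gromov-Bourdon visual distance `ρ_o`. -/
def visualDist (o : M) (ξ₁ ξ₂ : Boundary M) : ℝ :=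
  if ξ₁ = ξ₂ then 0 else (EReal.exp (-boundaryGromovProduct o ξ₁ ξ₂)).toReal

/-- The visual ball `𝔅(η, r)`, seen from `o`. -/
def visualBall (o : M) (η : Boundary M) (r : ℝ) : Set (Boundary M) := {ξ | visualDist o η ξ < r}

/-- `η = z⁺`: `η` is the extremity of the geodesic ray from `o` which contains `z`. -/
def IsExtremity (o z : M) (η : Boundary M) : Prop := z ∈ rayTo o η

/-- The visual ball `𝔅(z⁺, r)` centered at the extremity `z⁺` of the geodesic ray from `o` which
contains `z ≠ o`. (In a complete simply connected manifold of nonpositive curvature there is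
exactly one `η` with `IsExtremity o z η`.) -/
def extremityBall (o z : M) (r : ℝ) : Set (Boundary M) :=
  {ξ | ∀ η, IsExtremity o z η → ξ ∈ visualBall o η r}

end Boundary

/-! ### Groups of isometries and their limit sets -/

section Groups

variable {M : Type*} [MetricSpace M]

/-- A Kleinian group: a group of isometries that is discrete in the compact-open topology. -/
def IsKleinian (Γ : Subgroup (M ≃ᵢ M)) : Prop :=
  DiscreteTopology ((fun γ : M ≃ᵢ M => (⟨γ, γ.continuous⟩ : C(M, M))) '' (Γ : Set (M ≃ᵢ M)))

/-- The orbit `Γ · o`. -/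
def orbit (Γ : Subgroup (M ≃ᵢ M)) (o : M) : Set M := range fun γ : Γ => (γ : M ≃ᵢ M) o

/-- The limit set `Λ`: the boundary points in the closure of `Γ · o` for the cone topology. -/
def limitSet (Γ : Subgroup (M ≃ᵢ M)) (o : M) : Set (Boundary M) :=
  {ξ | (coneNhds o ξ ⊓ 𝓟 (orbit Γ o)).NeBot}

/-- The `α`-linear escape limit set `Λˡ(α)`. -/
def linearEscapeLimitSet (Γ : Subgroup (M ≃ᵢ M)) (o : M) (α : ℝ) : Set (Boundary M) :=
  {ξ ∈ limitSet Γ o |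
    α < liminf (fun t : ℝ≥0 => (1 / (t : ℝ)) * Metric.infDist (ξ.point o t) (orbit Γ o)) atTop}

/-- The `κ`-weakly recurrent limit set `Λʳ(κ)`. -/
def weaklyRecurrentLimitSet (Γ : Subgroup (M ≃ᵢ M)) (o : M) (κ : ℝ) : Set (Boundary M) :=
  ⋃ c : {c : ℝ // 0 < c}, {ξ ∈ limitSet Γ o |
    {γ : Γ | (γ : M ≃ᵢ M) o ≠ o ∧
      ξ ∈ extremityBall o ((γ : M ≃ᵢ M) o)
        (c * Real.exp (-(1 / (1 + κ)) * dist o ((γ : M ≃ᵢ M) o)))}.Infinite}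

end Groups

end KleinianLimit

end

/-
If `z = γ o` satisfies `d(ξ_t, z) ≤ β t`, the triangle inequality alone gives
`⟨z, ξ_t⟩_o ≥ d(o, z) / (1 + β)`. Gromov products increase along geodesics from `o`, so
`⟨z⁺, ξ⟩_o ≥ d(o, z) / (1 + β)`, that is, `ρ(z⁺, ξ) ≤ exp (-d(o, z) / (1 + β))`. If `ξ` does not
escape `α`-linearly and `α < β < 1`, such `z` exist for arbitrarily large `t`, and
`d(o, z) ≥ (1 - β) t` shows that infinitely many of them occur.
-/

namespace KleinianLimit

section GromovProduct

variable {M : Type*} [MetricSpace M] {o x x₁ x₂ y₁ y₂ w₁ w₂ z : M}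

theorem gromovProduct_le_of_mem_geodSegment (h₁ : x₁ ∈ geodSegment o w₁)
    (h₂ : x₂ ∈ geodSegment o w₂) : gromovProduct o x₁ x₂ ≤ gromovProduct o w₁ w₂ := by
  simp only [geodSegment, mem_ofPred_eq] at h₁ h₂
  simp only [gromovProduct, dist_comm x₁ o, dist_comm w₁ o]
  linarith [dist_triangle4 w₁ x₁ x₂ w₂, dist_comm w₁ x₁]

theorem gromovProduct_le_add_dist_add_dist :
    gromovProduct o y₁ y₂ ≤ gromovProduct o x₁ x₂ + dist x₁ y₁ + dist x₂ y₂ := by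
  simp only [gromovProduct]
  linarith [dist_triangle y₁ x₁ o, dist_triangle o x₂ y₂, dist_triangle4 x₁ y₁ y₂ x₂,
    dist_comm x₁ y₁, dist_comm x₂ y₂]

theorem dist_div_one_add_le_gromovProduct {β : ℝ} (hβ₀ : 0 ≤ β) (hβ₁ : β ≤ 1)
    (h : dist x z ≤ β * dist o x) : dist o z / (1 + β) ≤ gromovProduct o z x := by
  have hz : dist o z ≤ (1 + β) * dist o x := by linarith [dist_triangle o x z]
  rw [div_le_iff₀ (by linarith)]
  calc dist o z = ((1 + β) * dist o z + (1 - β) * dist o z) / 2 := by ring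
    _ ≤ ((1 + β) * dist o z + (1 - β) * ((1 + β) * dist o x)) / 2 := by
      have : 0 ≤ 1 - β := by linarith
      gcongr
    _ = (dist o z + dist o x - β * dist o x) / 2 * (1 + β) := by ring
    _ ≤ gromovProduct o z x * (1 + β) := by
      rw [gromovProduct, dist_comm z o, dist_comm z x]
      gcongr

end GromovProduct

section VisualDistance

variable {M : Type*} [MetricSpace M] {o x z : M} {ξ η : Boundary M}

theorem eventually_coneNhds_exists_dist_lt (ξ : Boundary M) (T : ℝ≥0) {ε : ℝ} (hε : 0 < ε) :
    ∀ᶠ w in coneNhds o ξ, ∃ x ∈ geodSegment o w, dist o x = T ∧ dist x (ξ.point o T) < ε :=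
  mem_of_superset
    (mem_iInf_of_mem T <| mem_iInf_of_mem ε <| mem_iInf_of_mem hε <| mem_principal_self _)
    fun _ hw => hw.2

theorem dist_point_of_neBot_coneNhds (hξ : (coneNhds o ξ).NeBot) (t : ℝ≥0) :
    dist o (ξ.point o t) = t := by
  refine eq_of_forall_dist_le fun ε hε => ?_
  obtain ⟨_, x, -, hx, hdist⟩ := (eventually_coneNhds_exists_dist_lt (o := o) ξ t hε).exists
  rw [← hx, dist_comm]
  exact (dist_dist_dist_le_right o x _).trans hdist.le

theorem eventually_lt_gromovProduct (hz : z ∈ rayTo o η) (hx : x ∈ rayTo o ξ) {r : ℝ}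
    (hr : r < gromovProduct o z x) :
    ∀ᶠ w in coneNhds o η ×ˢ coneNhds o ξ, r < gromovProduct o w.1 w.2 := by
  obtain ⟨s, rfl⟩ := hz
  obtain ⟨t, rfl⟩ := hx
  have hε := half_pos (sub_pos.2 hr)
  filter_upwards [(eventually_coneNhds_exists_dist_lt η s hε).prod_mk
    (eventually_coneNhds_exists_dist_lt ξ t hε)]
  rintro w ⟨⟨x₁, hx₁, -, hd₁⟩, x₂, hx₂, -, hd₂⟩
  have hle := gromovProduct_le_of_mem_geodSegment hx₁ hx₂
  have hnear := gromovProduct_le_add_dist_add_dist (o := o) (x₁ := x₁) (x₂ := x₂)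
    (y₁ := η.point o s) (y₂ := ξ.point o t)
  linarith

theorem gromovProduct_le_boundaryGromovProduct (hz : z ∈ rayTo o η) (hx : x ∈ rayTo o ξ) :
    (gromovProduct o z x : EReal) ≤ boundaryGromovProduct o η ξ := by
  refine EReal.ge_of_forall_gt_iff_ge.1 fun r hr => ?_
  refine le_liminf_of_le (by isBoundedDefault) ?_
  filter_upwards [eventually_lt_gromovProduct hz hx (EReal.coe_lt_coe_iff.1 hr)] with w hw
  exact EReal.coe_le_coe_iff.2 hw.le

theorem visualDist_le_exp_neg_gromovProduct (hz : z ∈ rayTo o η) (hx : x ∈ rayTo o ξ) :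
    visualDist o η ξ ≤ Real.exp (-gromovProduct o z x) := by
  unfold visualDist
  split_ifs
  · positivity
  · refine ENNReal.toReal_le_of_le_ofReal (Real.exp_pos _).le ?_
    rw [← EReal.exp_coe, EReal.coe_neg]
    exact EReal.exp_monotone
      (EReal.neg_le_neg_iff.2 (gromovProduct_le_boundaryGromovProduct hz hx))

theorem mem_extremityBall_of_dist_le_mul {β κ : ℝ} (hβ₀ : 0 ≤ β) (hβ₁ : β ≤ 1) (hβκ : β < κ)
    (hz : z ≠ o) (hx : x ∈ rayTo o ξ) (h : dist x z ≤ β * dist o x) :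
    ξ ∈ extremityBall o z (Real.exp (-(1 / (1 + κ)) * dist o z)) := by
  intro η hη
  have hpos : 0 < dist o z := dist_pos.2 hz.symm
  calc visualDist o η ξ ≤ Real.exp (-gromovProduct o z x) :=
        visualDist_le_exp_neg_gromovProduct hη hx
    _ ≤ Real.exp (-(dist o z / (1 + β))) := by
      gcongr
      exact dist_div_one_add_le_gromovProduct hβ₀ hβ₁ h
    _ < Real.exp (-(1 / (1 + κ)) * dist o z) := by
      rw [neg_mul, one_div_mul_eq_div]
      gcongr

end VisualDistance

section LinearEscape

variable {M : Type*} [MetricSpace M] {o : M} {Γ : Subgroup (M ≃ᵢ M)} {ξ : Boundary M} {α β κ : ℝ}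

theorem mem_orbit_self : o ∈ orbit Γ o := ⟨1, rfl⟩

theorem dist_point_of_mem_limitSet (hξ : ξ ∈ limitSet Γ o) (t : ℝ≥0) :
    dist o (ξ.point o t) = t :=
  dist_point_of_neBot_coneNhds (NeBot.mono hξ inf_le_left) t

theorem infDist_point_orbit_le (hξ : ξ ∈ limitSet Γ o) (t : ℝ≥0) :
    Metric.infDist (ξ.point o t) (orbit Γ o) ≤ t := by
  rw [← dist_point_of_mem_limitSet hξ t, dist_comm]
  exact Metric.infDist_le_dist_of_mem mem_orbit_self

theorem frequently_infDist_point_orbit_lt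
    (hξ : ξ ∈ limitSet Γ o \ linearEscapeLimitSet Γ o α) (hαβ : α < β) :
    ∃ᶠ t : ℝ≥0 in atTop, Metric.infDist (ξ.point o t) (orbit Γ o) < β * t := by
  have hliminf : liminf (fun t : ℝ≥0 =>
      (1 / (t : ℝ)) * Metric.infDist (ξ.point o t) (orbit Γ o)) atTop < β :=
    (not_lt.1 fun h => hξ.2 ⟨hξ.1, h⟩).trans_lt hαβ
  have hle : ∀ t : ℝ≥0, (1 / (t : ℝ)) * Metric.infDist (ξ.point o t) (orbit Γ o) ≤ 1 := by
    intro t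
    rw [one_div_mul_eq_div]
    exact div_le_one_of_le₀ (infDist_point_orbit_le hξ.1 t) t.2
  refine ((frequently_lt_of_liminf_lt (isCoboundedUnder_ge_of_le atTop hle)
    hliminf).and_eventually (eventually_gt_atTop 0)).mono fun t ⟨hlt, ht⟩ => ?_
  rwa [one_div_mul_eq_div, div_lt_iff₀ (NNReal.coe_pos.2 ht)] at hlt

theorem exists_mem_orbit_dist_point_lt
    (hξ : ξ ∈ limitSet Γ o \ linearEscapeLimitSet Γ o α) (hαβ : α < β) (hβ : β < 1) (R : ℝ) :
    ∃ z ∈ orbit Γ o, R < dist o z ∧ ∃ t : ℝ≥0, dist (ξ.point o t) z < β * t := by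
  obtain ⟨t, hlt, ht⟩ := ((frequently_infDist_point_orbit_lt hξ hαβ).and_eventually
    (eventually_gt_atTop (Real.toNNReal (R / (1 - β))))).exists
  obtain ⟨z, hz, hdist⟩ := (Metric.infDist_lt_iff ⟨o, mem_orbit_self⟩).1 hlt
  refine ⟨z, hz, ?_, t, hdist⟩
  have hR : R < t * (1 - β) :=
    (div_lt_iff₀ (by linarith)).1 ((Real.le_coe_toNNReal _).trans_lt (NNReal.coe_lt_coe.2 ht))
  have htri := dist_triangle_right o (ξ.point o t) z
  rw [dist_point_of_mem_limitSet hξ.1] at htri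
  linarith

theorem infinite_orbit_mem_extremityBall
    (hξ : ξ ∈ limitSet Γ o \ linearEscapeLimitSet Γ o α) (hα : α < 1) (hακ : α < κ) :
    {z ∈ orbit Γ o | z ≠ o ∧
      ξ ∈ extremityBall o z (Real.exp (-(1 / (1 + κ)) * dist o z))}.Infinite := by
  obtain ⟨β, hαβ, hβ⟩ := exists_between (lt_min hακ hα)
  obtain ⟨hβκ, hβ₁⟩ := lt_min_iff.1 hβ
  refine Infinite.of_image (dist o) (infinite_of_forall_exists_gt fun R => ?_)
  obtain ⟨z, hz, hR, t, hdist⟩ := exists_mem_orbit_dist_point_lt hξ hαβ hβ₁ (max R 0)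
  have hne : z ≠ o := (dist_pos.1 ((le_max_right R 0).trans_lt hR)).symm
  have hβ₀ : 0 ≤ β := (pos_of_mul_pos_left (dist_nonneg.trans_lt hdist) t.2).le
  rw [← dist_point_of_mem_limitSet hξ.1 t] at hdist
  exact ⟨dist o z, mem_image_of_mem _ ⟨hz, hne, mem_extremityBall_of_dist_le_mul hβ₀ hβ₁.le hβκ hne
    (mem_range_self t) hdist.le⟩, (le_max_left R 0).trans_lt hR⟩

end LinearEscape

section Exponent

variable {β : ℝ}

theorem lt_two_mul_div_one_sub (hβ : 0 < β) (h : 0 < 1 - 2 * β - β ^ 2) :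
    β < 2 * β / (1 - 2 * β - β ^ 2) := by
  rw [lt_div_iff₀ h]
  nlinarith

theorem one_div_one_add_two_mul_div_one_sub (h : 1 - 2 * β - β ^ 2 ≠ 0) :
    1 / (1 + 2 * β / (1 - 2 * β - β ^ 2)) = (1 - 2 * β - β ^ 2) / (1 - β ^ 2) := by
  rw [one_add_div h, one_div_div]
  ring

end Exponent

end KleinianLimit

open KleinianLimit in
theorem proposition3p2_general {M : Type*} [MetricSpace M] (o : M) (Γ : Subgroup (M ≃ᵢ M))
    {α κ : ℝ} (hα : α < 1) (hακ : α < κ) :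
    (∀ ξ ∈ limitSet Γ o \ linearEscapeLimitSet Γ o α,
      ∃ γ : ℕ → Γ, Function.Injective (fun k => (γ k : M ≃ᵢ M) o) ∧
        ∀ k, (γ k : M ≃ᵢ M) o ≠ o ∧
          ξ ∈ extremityBall o ((γ k : M ≃ᵢ M) o)
            (Real.exp (-(1 / (1 + κ)) * dist o ((γ k : M ≃ᵢ M) o)))) ∧
    limitSet Γ o \ linearEscapeLimitSet Γ o α ⊆ weaklyRecurrentLimitSet Γ o κ := by
  refine ⟨fun ξ hξ => ?_, fun ξ hξ => ?_⟩ <;>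
    have hinf := infinite_orbit_mem_extremityBall hξ hα hακ
  · let z := hinf.natEmbedding
    have horbit : ∀ k, ∃ γ : Γ, (γ : M ≃ᵢ M) o = z k := fun k => (z k).2.1
    choose γ hγ using horbit
    refine ⟨γ, ?_⟩
    simp only [hγ]
    exact ⟨Subtype.val_injective.comp z.injective, fun k => (z k).2.2⟩
  · refine mem_iUnion.2 ⟨⟨1, one_pos⟩, hξ.1, ?_⟩
    simp only [one_mul]
    refine Infinite.of_image (fun γ : Γ => (γ : M ≃ᵢ M) o) (hinf.mono ?_)
    rintro _ ⟨⟨γ, rfl⟩, hγ⟩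
    exact mem_image_of_mem _ hγ

theorem proposition3p2 (n : ℕ) (M : Type*) [MetricSpace M]
    [ChartedSpace (EuclideanSpace ℝ (Fin n)) M]
    [IsManifold 𝓘(ℝ, EuclideanSpace ℝ (Fin n)) ∞ M]
    [RiemannianBundle (fun x : M => TangentSpace 𝓘(ℝ, EuclideanSpace ℝ (Fin n)) x)]
    [IsContMDiffRiemannianBundle 𝓘(ℝ, EuclideanSpace ℝ (Fin n)) ∞ (EuclideanSpace ℝ (Fin n))
      (fun x : M => TangentSpace 𝓘(ℝ, EuclideanSpace ℝ (Fin n)) x)]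
    [IsRiemannianManifold 𝓘(ℝ, EuclideanSpace ℝ (Fin n)) M]
    [CompleteSpace M] [SimplyConnectedSpace M]
    (b : ℝ) (hb : 1 ≤ b) (hM : KleinianLimit.PinchedCurvature n M b)
    (o : M) (Γ : Subgroup (M ≃ᵢ M)) (hΓ : KleinianLimit.IsKleinian Γ)
    (α β : ℝ) (hα : 0 < α) (hαβ : α < β) (hβ : β < 1 / 5) :
    (∀ ξ ∈ KleinianLimit.limitSet Γ o \ KleinianLimit.linearEscapeLimitSet Γ o α,
      ∃ c : ℝ, 1 ≤ c ∧ ∃ γ : ℕ → Γ,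
        Function.Injective (fun k => (γ k : M ≃ᵢ M) o) ∧
        ∀ k, (γ k : M ≃ᵢ M) o ≠ o ∧
          ξ ∈ KleinianLimit.extremityBall o ((γ k : M ≃ᵢ M) o)
            (c * Real.exp (-((1 - 2 * β - β ^ 2) / (1 - β ^ 2)) *
              dist o ((γ k : M ≃ᵢ M) o)))) ∧
    KleinianLimit.limitSet Γ o \ KleinianLimit.linearEscapeLimitSet Γ o α ⊆
      KleinianLimit.weaklyRecurrentLimitSet Γ o (2 * β / (1 - 2 * β - β ^ 2)) := by
  have hpos : 0 < 1 - 2 * β - β ^ 2 := by nlinarith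
  obtain ⟨hseq, hsub⟩ := proposition3p2_general o Γ (α := α) (by linarith)
    (hαβ.trans (KleinianLimit.lt_two_mul_div_one_sub (hα.trans hαβ) hpos))
  simp only [KleinianLimit.one_div_one_add_two_mul_div_one_sub hpos.ne'] at hseq
  exact ⟨fun ξ hξ => ⟨1, le_rfl, by simpa only [one_mul] using hseq ξ hξ⟩, hsub⟩
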